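/- Let $N$ be a set of $n$ agents and let $D_1,\dots,D_p$ be disjoint sets of items, $|D_i|=n$ for each type $i$, with one unit of supply of each item. A bundle is an element $x=(x_1,\dots,x_p)$ of $\mathcal D=D_1\times\dots\times D_p$. Each agent $j$ has a strict linear order $\succ_j$ on $\mathcal D$ that is lexicographic: there are a strict linear order $\rhd_j$ on the types (importance order) and a strict linear order $\succ_j^i$ on each $D_i$ such that $x\succ_j y$ if and only if for some type $i$, $x_i\succ_j^i y_i$ and $x_{i'}=y_{i'}$ for all $i'\rhd_j i$. A fractional assignment is a matrix $P=(p_{j,x})_{j\in N,\,x\in\mathcal D}$ with entries in $[0,1]$, with $\sum_x p_{j,x}=1$ for every agent $j$ and $\sum_j\sum_{x:\,x_i=o}p_{j,x}=1$ for every type $i$ and item $o\in D_i$. It is discrete if all its entries are $0$ or $1$, and decomposable if it is a convex combination of discrete assignments. Write $Q_j\succeq^{sd}_j P_k$ if $\sum_{y\in U_j(x)}q_{j,y}\ge\sum_{y\in U_j(x)}p_{k,y}$ for all $x\in\mathcal D$, where $U_j(x)=\{y:y\succ_j x\}\cup\{x\}$. A fractional assignment $P$ is sd-efficient if there is no fractional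 assignment $Q\ne P$ with $Q_j\succeq^{sd}_jP_j$ for all $j$, and sd-envy-free if $P_j\succeq^{sd}_jP_k$ for all agents $j,k$. The LexiPS mechanism works as follows. All supplies start at $1$ and all shares at $0$. There are $p$ phases $k=1,\dots,p$, each of duration $1$. In phase $k$ every agent $j$ consumes, at rate one unit per unit of time, items of her $k$-th most important type only, at each moment the $\succ_j^i$-best item of that type $i$ that is not yet exhausted; consumption of a type pauses whenever an item being consumed is exhausted, after which every agent consuming that type turns to her best remaining item of it, and the phase ends when its timer reaches $1$. Let $p^i_{j,o}$ be the total amount of item $o\in D_i$ consumed by agent $j$. The output is $P$ with $p_{j,x}=\prod_{i=1}^p p^i_{j,x_i}$. Theorem. For every profile of lexicographic preferences, the output of LexiPS is a fractional assignment that is sd-efficient, sd-envy-free and decomposable. That is, for multi-type allocation with lexicographic preferences the LexiPS mechanism satisfies sd-efficiency and sd-envy-freeness, and its outputs are always decomposable (hence applicable to indivisible items). -/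

import Mathlib

/-- Bundles: one item of each type, `D i` being the set of items of type `i`. -/
abbrev MTRA.Bundle {p : ℕ} (D : Fin p → Type*) : Type _ := ∀ i, D i

namespace MTRA

noncomputable section

variable {p : ℕ} {N : Type*} [Fintype N] {D : Fin p → Type*} [∀ i, Fintype (D i)]

/-! ### Fractional and discrete assignments -/

open scoped Classical in
/-- A matrix `P`, with `P j x` the share of bundle `x` given to agent `j`, is a fractional
assignment: shares lie in `[0,1]`, every agent receives one unit in total, and the unit supply of
every item `o` of every type `i` is exactly used. -/
structure IsFractionalAssignment (P : N → Bundle D → ℝ) : Prop where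
  nonneg : ∀ j x, 0 ≤ P j x
  le_one : ∀ j x, P j x ≤ 1
  demand : ∀ j, ∑ x, P j x = 1
  supply : ∀ (i : Fin p) (o : D i), ∑ j, ∑ x with x i = o, P j x = 1

/-- A discrete assignment is a fractional assignment all of whose entries are `0` or `1`. -/
def IsDiscreteAssignment (A : N → Bundle D → ℝ) : Prop :=
  IsFractionalAssignment A ∧ ∀ j x, A j x = 0 ∨ A j x = 1

/-- `P` is decomposable: a convex combination of discrete assignments. -/
def IsDecomposable (P : N → Bundle D → ℝ) : Prop :=
  P ∈ convexHull ℝ {A : N → Bundle D → ℝ | IsDiscreteAssignment A}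

/-! ### Stochastic dominance, efficiency and envy-freeness

A preference `r` is read as `r x y` iff `x` is strictly preferred to `y`. -/

open scoped Classical in
/-- The upper contour set `{y | y ≻ x} ∪ {x}`. -/
def upperContour (r : Bundle D → Bundle D → Prop) (x : Bundle D) : Finset (Bundle D) :=
  {y | r y x ∨ y = x}

/-- The allocation `a` weakly stochastically dominates `b` with respect to `r`. -/
def SdDominates (r : Bundle D → Bundle D → Prop) (a b : Bundle D → ℝ) : Prop :=
  ∀ x, ∑ y ∈ upperContour r x, b y ≤ ∑ y ∈ upperContour r x, a y

/-- There is no other fractional assignment that weakly dominates `P` for every agent. -/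
def IsSdEfficient (R : N → Bundle D → Bundle D → Prop) (P : N → Bundle D → ℝ) : Prop :=
  ¬ ∃ Q : N → Bundle D → ℝ,
    IsFractionalAssignment Q ∧ Q ≠ P ∧ ∀ j, SdDominates (R j) (Q j) (P j)

/-- Every agent weakly prefers her own allocation to that of any agent. -/
def IsSdEnvyFree (R : N → Bundle D → Bundle D → Prop) (P : N → Bundle D → ℝ) : Prop :=
  ∀ j k, SdDominates (R j) (P j) (P k)

/-! ### Lexicographic preferences -/

/-- An importance order on the types (`imp i i'`: type `i` is more important than `i'`) together
with a strict linear order on the items of each type (`item i o o'`: `o` is preferred to `o'`). -/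
structure LexOrder (D : Fin p → Type*) where
  imp : Fin p → Fin p → Prop
  imp_order : IsStrictTotalOrder (Fin p) imp
  item : ∀ i, D i → D i → Prop
  item_order : ∀ i, IsStrictTotalOrder (D i) (item i)

/-- `r` is the lexicographic preference given by the importance order and item orders of `L`. -/
def LexOrder.Represents (L : LexOrder D) (r : Bundle D → Bundle D → Prop) : Prop :=
  ∀ x y, r x y ↔ ∃ i, L.item i (x i) (y i) ∧ ∀ i', L.imp i' i → x i' = y i'

open scoped Classical in
/-- The number of types that are more important than `i`. -/
def LexOrder.rank (L : LexOrder D) (i : Fin p) : ℕ :=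
  Finset.card {i' : Fin p | L.imp i' i}

/-! ### One phase of simultaneous eating within one type

`E` is the set of items of the type, `A` the set of agents that consume this type in the phase, and
`pref j` the order of agent `j` on `E`. -/

/-- Remaining supplies, accumulated shares, and the timer of the phase. -/
structure EatState (N : Type*) (E : Type*) where
  supply : E → ℝ
  share : N → E → ℝ
  timer : ℝ

variable {E : Type*} [Fintype E]

/-- `o` is the best unexhausted item. -/
def IsTopItem (r : E → E → Prop) (supply : E → ℝ) (o : E) : Prop :=
  0 < supply o ∧ ∀ o', 0 < supply o' → o' ≠ o → r o o'

open scoped Classical in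
/-- The number of agents that are currently consuming `o`. -/
def eaters (A : Finset N) (pref : N → E → E → Prop) (s : EatState N E) (o : E) : ℕ :=
  Finset.card {j ∈ A | IsTopItem (pref j) s.supply o}

open scoped Classical in
/-- The duration until the next pause: the first moment at which an item being consumed gets
exhausted or the timer reaches one. -/
def progress (A : Finset N) (pref : N → E → E → Prop) (s : EatState N E) : ℝ :=
  (insert (1 - s.timer)
    (Finset.image (fun o => s.supply o / eaters A pref s o)
      {o | 0 < eaters A pref s o})).min' (Finset.insert_nonempty _ _)

open scoped Classical in
/-- One iteration of `while t < 1`: every agent in `A` consumes her best unexhausted item, at unit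
rate, until the next pause. Nothing happens once the timer has reached one. -/
def eatStep (A : Finset N) (pref : N → E → E → Prop) (s : EatState N E) : EatState N E :=
  if s.timer < 1 then
    { supply := fun o => s.supply o - progress A pref s * eaters A pref s o
      share := fun j o => s.share j o +
        if j ∈ A ∧ IsTopItem (pref j) s.supply o then progress A pref s else 0
      timer := s.timer + progress A pref s }
  else s

/-- The state at the end of a phase. The loop `while t < 1` needs at most `|E| + 1` iterations
(see `eatPhase_timer`), and further iterations change nothing. -/
def eatPhase (A : Finset N) (pref : N → E → E → Prop) (supply : E → ℝ) (share : N → E → ℝ) :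
    EatState N E :=
  (eatStep A pref)^[Fintype.card E + 1] ⟨supply, share, 0⟩

/-! ### The mechanism -/

open scoped Classical in
/-- Remaining supplies and accumulated shares of the items of every type after `k` phases. In phase
`k` (counted from zero) the agents consuming type `i` are those for which exactly `k` types are more
important than `i`. -/
def lexiPSLoop (L : N → LexOrder D) : ℕ → ∀ i, (D i → ℝ) × (N → D i → ℝ)
  | 0 => fun _ => (fun _ => 1, fun _ _ => 0)
  | k + 1 => fun i =>
      let s := eatPhase {j | (L j).rank i = k} (fun j => (L j).item i)
        (lexiPSLoop L k i).1 (lexiPSLoop L k i).2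
      (s.supply, s.share)

/-- The share of item `o` of type `i` that agent `j` has consumed after all `p` phases. -/
def lexiPSItem (L : N → LexOrder D) (i : Fin p) (j : N) (o : D i) : ℝ :=
  (lexiPSLoop L p i).2 j o

/-- The output of LexiPS: the share of a bundle is the product of the shares of its items. -/
def lexiPS (L : N → LexOrder D) (j : N) (x : Bundle D) : ℝ :=
  ∏ i, lexiPSItem L i j (x i)

/-! ### The loop of each phase terminates within the given number of iterations -/

open scoped Classical in
theorem eatStep_timer_or (A : Finset N) (pref : N → E → E → Prop) (s : EatState N E)
    (hs : s.timer < 1) :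
    (eatStep A pref s).timer = 1 ∨
      ((eatStep A pref s).timer ≤ 1 ∧
        Finset.card {o | 0 < (eatStep A pref s).supply o} < Finset.card {o | 0 < s.supply o}) := by
  have hpos : ∀ o, 0 < eaters A pref s o → 0 < s.supply o := by
    intro o ho
    obtain ⟨j, hj⟩ := Finset.card_pos.mp ho
    exact (Finset.mem_filter.mp hj).2.1
  have hle : progress A pref s ≤ 1 - s.timer :=
    Finset.min'_le _ _ (Finset.mem_insert_self _ _)
  have hmem := Finset.min'_mem (insert (1 - s.timer)
    (Finset.image (fun o => s.supply o / eaters A pref s o)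
      {o | 0 < eaters A pref s o})) (Finset.insert_nonempty _ _)
  change progress A pref s ∈ _ at hmem
  rcases Finset.mem_insert.mp hmem with h | h
  · left
    simp only [eatStep, hs, if_true, h]
    ring
  · right
    obtain ⟨o, ho, hoe⟩ := Finset.mem_image.mp h
    have ho' : 0 < eaters A pref s o := (Finset.mem_filter.mp ho).2
    have hc : (0 : ℝ) < eaters A pref s o := by exact_mod_cast ho'
    have hp : 0 ≤ progress A pref s := by
      rw [← hoe]; exact (div_pos (hpos o ho') hc).le
    refine ⟨by simp only [eatStep, hs, if_true]; linarith, ?_⟩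
    apply Finset.card_lt_card
    refine Finset.ssubset_iff_subset_ne.mpr ⟨?_, ?_⟩
    · intro q hq
      simp only [eatStep, hs, if_true, Finset.mem_filter, Finset.mem_univ, true_and] at hq ⊢
      have : 0 ≤ progress A pref s * eaters A pref s q := by positivity
      linarith
    · intro heq
      have h1 : o ∈ ({o | 0 < s.supply o} : Finset E) := by simpa using hpos o ho'
      rw [← heq] at h1
      simp only [eatStep, hs, if_true, Finset.mem_filter, Finset.mem_univ, true_and] at h1
      rw [← hoe, div_mul_cancel₀ _ hc.ne'] at h1
      linarith

open scoped Classical in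
theorem eatStep_iterate_timer (A : Finset N) (pref : N → E → E → Prop) (k : ℕ) :
    ∀ s : EatState N E, s.timer ≤ 1 → Finset.card {o | 0 < s.supply o} < k →
      ((eatStep A pref)^[k] s).timer = 1 := by
  have hfix : ∀ (m : ℕ) (s : EatState N E), s.timer = 1 →
      ((eatStep A pref)^[m] s).timer = 1 := by
    intro m s h
    rw [Function.iterate_fixed (by simp [eatStep, h])]
    exact h
  induction k with
  | zero => intro s _ h; omega
  | succ k ih =>
    intro s hs hk
    rcases hs.eq_or_lt with h | h
    · exact hfix _ s h
    · rw [Function.iterate_succ_apply]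
      rcases eatStep_timer_or A pref s h with h1 | ⟨h1, h2⟩
      · exact hfix _ _ h1
      · exact ih _ h1 (by omega)

/-- Every phase ends with the timer at one. -/
theorem eatPhase_timer (A : Finset N) (pref : N → E → E → Prop) (supply : E → ℝ)
    (share : N → E → ℝ) : (eatPhase A pref supply share).timer = 1 := by
  classical
  exact eatStep_iterate_timer A pref _ _ zero_le_one (Nat.lt_succ_of_le (Finset.card_le_univ _))

end

end MTRA

/-! Fix a type and let `τ k o` be the time in phase `k` at which item `o` runs out: `1` if it
survives the phase, `0` if it was gone before. An agent active in phase `k` eats only items at least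
as good as `o` while `o` lasts, so she collects at least `τ k o` from these. If she gets some of
`o`, she collects no more than that, because everything better was gone when she turned to `o`. An
item available in a later phase has `τ = 1` in all earlier ones. These facts, with unit row and
column sums (there are as many items as agents), make up `IsEating`; the rest of the proof sees the
eating process only through them.

Feasibility and decomposability: each type gives a doubly stochastic matrix. Apply Birkhoff to each
and multiply out.

Envy-freeness: the output is a product measure, so the mass of an upper contour set is a `lexSum`
over the types. Agents who rank a type equally satisfy weak dominance on it. If `j` ranks a type
differently from `k`, then some type at least as important to `j` is eaten earlier by `j` than by
`k`. There `j`'s mass strictly above an item is at least `k`'s mass weakly above it, which settles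
the lexicographic comparison (`lexSum_le_lexSum`).

Efficiency: let `Q`, not necessarily a product, dominate the output. By induction on `k`, both give
every agent the same distribution over her `k` most important items. Dominance then passes to the
marginal of the next type, `IsEating.eq_of_dominates` forces the marginals to agree, and equality of
marginals turns dominance given each prefix into equality. -/

namespace MTRA

noncomputable section

set_option linter.unusedSectionVars false

open scoped Classical

/-! ### Finite strict total orders -/

section Order

variable {E : Type*} [Fintype E] {r : E → E → Prop}

/-- The items that are at least as good as `o`. -/
def weakUpper (r : E → E → Prop) (o : E) : Finset E := {o' | r o' o ∨ o' = o}

/-- The items that are better than `o`. -/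
def strictUpper (r : E → E → Prop) (o : E) : Finset E := {o' | r o' o}

theorem mem_weakUpper {o o' : E} : o' ∈ weakUpper r o ↔ r o' o ∨ o' = o := by
  simp [weakUpper]

theorem mem_strictUpper {o o' : E} : o' ∈ strictUpper r o ↔ r o' o := by
  simp [strictUpper]

theorem sum_weakUpper [IsStrictTotalOrder E r] (f : E → ℝ) (o : E) :
    ∑ o' ∈ weakUpper r o, f o' = f o + ∑ o' ∈ strictUpper r o, f o' := by
  have h : weakUpper r o = insert o (strictUpper r o) := by
    ext o'
    rw [mem_weakUpper, Finset.mem_insert, mem_strictUpper, or_comm]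
  rw [h, Finset.sum_insert]
  rw [mem_strictUpper]
  exact irrefl_of r o

theorem weakUpper_subset_strictUpper [IsStrictTotalOrder E r] {o o' : E} (h : r o' o) :
    weakUpper r o' ⊆ strictUpper r o := by
  intro q hq
  rw [mem_strictUpper]
  rcases mem_weakUpper.1 hq with hq | rfl
  · exact trans_of r hq h
  · exact h

theorem exists_best [IsStrictTotalOrder E r] (s : Finset E) (hs : s.Nonempty) :
    ∃ o ∈ s, ∀ o' ∈ s, o' ≠ o → r o o' := by
  obtain ⟨o, ho, h⟩ := (Finite.wellFounded_of_trans_of_irrefl r).has_min (s : Set E) hs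
  refine ⟨o, ho, fun o' ho' hne => ?_⟩
  rcases trichotomous_of r o o' with h1 | h1 | h1
  · exact h1
  · exact absurd h1.symm hne
  · exact absurd h1 (h o' ho')

theorem exists_worst [IsStrictTotalOrder E r] (s : Finset E) (hs : s.Nonempty) :
    ∃ o ∈ s, ∀ o' ∈ s, o' ≠ o → r o' o := by
  have : IsStrictTotalOrder E (Function.swap r) := inferInstance
  exact exists_best (r := Function.swap r) s hs

/-- A function all of whose sums over upper sets vanish is zero. -/
theorem eq_zero_of_sum_weakUpper [IsStrictTotalOrder E r] {f : E → ℝ}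
    (h : ∀ o, ∑ o' ∈ weakUpper r o, f o' = 0) (o : E) : f o = 0 := by
  induction o using (Finite.wellFounded_of_trans_of_irrefl r).induction with
  | _ o ih =>
    have h1 := h o
    rwa [sum_weakUpper, Finset.sum_eq_zero fun o' ho' => ih o' (mem_strictUpper.1 ho'),
      add_zero] at h1

end Order

/-! ### The invariant of a phase -/

section Phase

variable {N E : Type*} [Fintype N] [Fintype E]

/-- The invariant of a phase with initial supplies `supply₀` and initial shares `share₀`. The value
`τ o` is the time at which `o` was exhausted, or the current time if `o` is still available. -/
structure EatInv (A : Finset N) (pref : N → E → E → Prop) (supply₀ : E → ℝ) (share₀ : N → E → ℝ)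
    (s : EatState N E) (τ : E → ℝ) : Prop where
  timer_nonneg : 0 ≤ s.timer
  timer_le : s.timer ≤ 1
  supply_nonneg : ∀ o, 0 ≤ s.supply o
  supply_le : ∀ o, s.supply o ≤ supply₀ o
  share_nonneg : ∀ j o, 0 ≤ s.share j o
  col : ∀ o, s.supply o + ∑ j, s.share j o = 1
  row : ∀ j ∈ A, ∑ o, s.share j o = s.timer
  frozen : ∀ j ∉ A, s.share j = share₀ j
  time_eq : ∀ o, 0 < s.supply o → τ o = s.timer
  time_le : ∀ o, τ o ≤ s.timer
  time_pos : ∀ o, 0 < τ o → 0 < supply₀ o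
  cum_le : ∀ j ∈ A, ∀ o, 0 < s.share j o → ∑ o' ∈ weakUpper (pref j) o, s.share j o' ≤ τ o
  le_cum : ∀ j ∈ A, ∀ o, τ o ≤ ∑ o' ∈ weakUpper (pref j) o, s.share j o'

variable {A : Finset N} {pref : N → E → E → Prop} {supply₀ : E → ℝ} {share₀ : N → E → ℝ}
  {s : EatState N E} {τ : E → ℝ}

theorem supply_pos_of_eaters_pos {o : E} (h : 0 < eaters A pref s o) : 0 < s.supply o := by
  obtain ⟨j, hj⟩ := Finset.card_pos.mp h
  exact (Finset.mem_filter.mp hj).2.1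

theorem progress_nonneg (hs : s.timer ≤ 1) : 0 ≤ progress A pref s := by
  unfold progress
  rw [Finset.le_min'_iff]
  intro y hy
  rcases Finset.mem_insert.1 hy with rfl | hy
  · linarith
  · obtain ⟨o, ho, rfl⟩ := Finset.mem_image.1 hy
    exact div_nonneg (supply_pos_of_eaters_pos (Finset.mem_filter.1 ho).2).le (Nat.cast_nonneg _)

theorem progress_le : progress A pref s ≤ 1 - s.timer :=
  Finset.min'_le _ _ (Finset.mem_insert_self _ _)

theorem progress_mul_eaters_le (hs : ∀ o, 0 ≤ s.supply o) (o : E) :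
    progress A pref s * eaters A pref s o ≤ s.supply o := by
  rcases Nat.eq_zero_or_pos (eaters A pref s o) with h | h
  · simpa [h] using hs o
  · have hc : (0 : ℝ) < eaters A pref s o := by exact_mod_cast h
    rw [← le_div_iff₀ hc]
    exact Finset.min'_le _ _ (Finset.mem_insert_of_mem
      (Finset.mem_image.2 ⟨o, Finset.mem_filter.2 ⟨Finset.mem_univ _, h⟩, rfl⟩))

theorem IsTopItem.unique {r : E → E → Prop} [IsStrictTotalOrder E r] {f : E → ℝ} {o o' : E}
    (h : IsTopItem r f o) (h' : IsTopItem r f o') : o' = o := by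
  by_contra hne
  exact asymm_of r (h.2 o' h'.1 hne) (h'.2 o h.1 (Ne.symm hne))

/-- As long as the timer is below one, every active agent finds an available item. -/
theorem EatInv.exists_isTopItem [∀ j, IsStrictTotalOrder E (pref j)]
    (hcard : Fintype.card E = Fintype.card N) (hrow : ∀ j ∉ A, ∑ o, share₀ j o ≤ 1)
    (h : EatInv A pref supply₀ share₀ s τ) (ht : s.timer < 1) {j : N} (hj : j ∈ A) :
    ∃ o, IsTopItem (pref j) s.supply o := by
  have hne : ∃ o, 0 < s.supply o := by
    -- If everything were exhausted, `|E| = |N|` units would have been eaten; but nobody exceeds one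
    -- unit and `j` is still below it.
    by_contra! hcon
    have hcol : ∀ o, ∑ j, s.share j o = 1 := fun o => by
      have := h.col o
      have := h.supply_nonneg o
      have := hcon o
      linarith
    have h1 : ∑ j, ∑ o, s.share j o = Fintype.card N := by
      rw [Finset.sum_comm, Finset.sum_congr rfl fun o _ => hcol o]
      simp [hcard]
    have h2 : ∑ j, ∑ o, s.share j o < ∑ _j : N, (1 : ℝ) := by
      refine Finset.sum_lt_sum (fun j' _ => ?_) ⟨j, Finset.mem_univ _, (h.row j hj).trans_lt ht⟩
      by_cases hj' : j' ∈ A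
      · exact (h.row j' hj').trans_le ht.le
      · rw [h.frozen j' hj']
        exact hrow j' hj'
    simp [h1] at h2
  obtain ⟨o₀, ho₀⟩ := hne
  obtain ⟨o, ho, hbest⟩ := exists_best (r := pref j) ({o | 0 < s.supply o} : Finset E)
    ⟨o₀, by simpa using ho₀⟩
  exact ⟨o, by simpa using ho, fun o' ho' hne => hbest o' (by simpa using ho') hne⟩

/-- In one step each active agent adds `δ` to a single item, her top item `q`; hence a cumulative
sum grows by `δ` or not at all, according to whether `q` lies in the upper set. -/
theorem EatInv.eatStep [∀ j, IsStrictTotalOrder E (pref j)]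
    (hcard : Fintype.card E = Fintype.card N) (hrow : ∀ j ∉ A, ∑ o, share₀ j o ≤ 1)
    (h : EatInv A pref supply₀ share₀ s τ) :
    ∃ τ', EatInv A pref supply₀ share₀ (eatStep A pref s) τ' := by
  by_cases ht : s.timer < 1
  swap
  · exact ⟨τ, by simpa [MTRA.eatStep, ht] using h⟩
  set δ := progress A pref s with hδ
  have hδ0 : 0 ≤ δ := progress_nonneg h.timer_le
  have hδ1 : δ ≤ 1 - s.timer := progress_le
  have hδs : ∀ o, δ * eaters A pref s o ≤ s.supply o := progress_mul_eaters_le h.supply_nonneg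
  have hstep : MTRA.eatStep A pref s =
      { supply := fun o => s.supply o - δ * eaters A pref s o
        share := fun j o => s.share j o +
          if j ∈ A ∧ IsTopItem (pref j) s.supply o then δ else 0
        timer := s.timer + δ } := by
    simp [MTRA.eatStep, ht, hδ]
  have htop := fun j (hj : j ∈ A) => h.exists_isTopItem hcard hrow ht hj
  have hbite : ∀ j ∈ A, ∀ q, IsTopItem (pref j) s.supply q → ∀ o,
      (if j ∈ A ∧ IsTopItem (pref j) s.supply o then δ else 0) = if o = q then δ else 0 := by
    intro j hj q hq o
    have : (j ∈ A ∧ IsTopItem (pref j) s.supply o) ↔ o = q :=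
      ⟨fun ho => hq.unique ho.2, fun ho => ⟨hj, ho ▸ hq⟩⟩
    simp only [this]
  have hcum : ∀ j ∈ A, ∀ q, IsTopItem (pref j) s.supply q → ∀ o,
      ∑ o' ∈ weakUpper (pref j) o, (s.share j o' +
        if j ∈ A ∧ IsTopItem (pref j) s.supply o' then δ else 0) =
      ∑ o' ∈ weakUpper (pref j) o, s.share j o' +
        if q ∈ weakUpper (pref j) o then δ else 0 := by
    intro j hj q hq o
    rw [Finset.sum_add_distrib, Finset.sum_congr rfl fun o' _ => hbite j hj q hq o',
      Finset.sum_ite_eq']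
  -- The test uses the supply before the step, so an item exhausted by this very step receives the
  -- time at its end.
  refine ⟨fun o => if 0 < s.supply o then s.timer + δ else τ o, ?_⟩
  rw [hstep]
  refine ⟨?_, ?_, ?_, ?_, ?_, ?_, ?_, ?_, ?_, ?_, ?_, ?_, ?_⟩
  · exact add_nonneg h.timer_nonneg hδ0
  · dsimp only; linarith
  · intro o
    have := hδs o
    dsimp only; linarith
  · intro o
    have := h.supply_le o
    have : 0 ≤ δ * eaters A pref s o := by positivity
    dsimp only; linarith
  · intro j o
    have := h.share_nonneg j o
    dsimp only
    split_ifs <;> linarith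
  · intro o
    have h1 := h.col o
    have h2 : ∑ j, (if j ∈ A ∧ IsTopItem (pref j) s.supply o then δ else 0)
        = δ * eaters A pref s o := by
      rw [← Finset.sum_filter, Finset.sum_const, nsmul_eq_mul, mul_comm, eaters]
      congr 3
      ext j
      simp
    dsimp only
    rw [Finset.sum_add_distrib, h2]
    linarith
  · intro j hj
    obtain ⟨q, hq⟩ := htop j hj
    dsimp only
    rw [Finset.sum_add_distrib, h.row j hj, Finset.sum_congr rfl fun o _ => hbite j hj q hq o]
    simp
  · intro j hj
    simp only [hj, false_and, if_false, add_zero]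
    exact h.frozen j hj
  · intro o ho
    have : 0 ≤ δ * eaters A pref s o := by positivity
    dsimp only at ho ⊢
    rw [if_pos (by linarith)]
  · intro o
    have := h.time_le o
    dsimp only
    split_ifs <;> linarith
  · intro o ho
    split_ifs at ho with hs
    · exact hs.trans_le (h.supply_le o)
    · exact h.time_pos o ho
  · intro j hj o ho
    obtain ⟨q, hq⟩ := htop j hj
    dsimp only at ho ⊢
    rw [hcum j hj q hq]
    have htot : ∑ o' ∈ weakUpper (pref j) o, s.share j o' ≤ s.timer := by
      rw [← h.row j hj]
      exact Finset.sum_le_sum_of_subset_of_nonneg (Finset.subset_univ _)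
        fun o' _ _ => h.share_nonneg j o'
    by_cases hs : 0 < s.supply o
    · rw [if_pos hs]
      split_ifs <;> linarith
    · have hoq : o ≠ q := fun e => hs (e ▸ hq.1)
      rw [hbite j hj q hq, if_neg hoq, add_zero] at ho
      rw [if_neg hs]
      have hle := h.cum_le j hj o ho
      rw [if_neg, add_zero]
      · exact hle
      -- An available `q` better than `o` would already account for all that `j` has eaten, leaving
      -- no room for her positive share of `o`.
      · intro hmem
        have hqo : pref j q o := (mem_weakUpper.1 hmem).resolve_right hoq.symm
        have h1 := h.le_cum j hj q
        rw [h.time_eq q hq.1] at h1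
        have h2 : ∑ o' ∈ weakUpper (pref j) q, s.share j o' ≤
            ∑ o' ∈ strictUpper (pref j) o, s.share j o' :=
          Finset.sum_le_sum_of_subset_of_nonneg (weakUpper_subset_strictUpper hqo)
            fun o' _ _ => h.share_nonneg j o'
        rw [sum_weakUpper] at htot
        linarith
  · intro j hj o
    obtain ⟨q, hq⟩ := htop j hj
    dsimp only
    rw [hcum j hj q hq]
    have h1 := h.le_cum j hj o
    by_cases hs : 0 < s.supply o
    · rw [if_pos hs, if_pos]
      · rw [h.time_eq o hs] at h1
        linarith
      · rw [mem_weakUpper]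
        by_cases e : q = o
        · exact Or.inr e
        · exact Or.inl (hq.2 o hs (Ne.symm e))
    · rw [if_neg hs]
      split_ifs <;> linarith

theorem exists_eatInv_eatPhase [∀ j, IsStrictTotalOrder E (pref j)]
    (hcard : Fintype.card E = Fintype.card N)
    (hsupply : ∀ o, 0 ≤ supply₀ o) (hshare : ∀ j o, 0 ≤ share₀ j o)
    (hcol : ∀ o, supply₀ o + ∑ j, share₀ j o = 1)
    (hA : ∀ j ∈ A, ∀ o, share₀ j o = 0) (hrow : ∀ j ∉ A, ∑ o, share₀ j o ≤ 1) :
    ∃ τ, EatInv A pref supply₀ share₀ (eatPhase A pref supply₀ share₀) τ := by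
  unfold eatPhase
  generalize Fintype.card E + 1 = n
  induction n with
  | zero =>
    -- Items with no supply at the start keep the value `0` for ever, which is what `time_pos`
    -- records.
    refine ⟨fun _ => 0, le_rfl, zero_le_one, hsupply, fun _ => le_rfl, hshare, hcol, ?_,
      fun _ _ => rfl, fun _ _ => rfl, fun _ => le_rfl, fun _ h => absurd h (lt_irrefl _), ?_, ?_⟩
    · exact fun j hj => Finset.sum_eq_zero fun o _ => hA j hj o
    · intro j hj o ho
      exact absurd ho (hA j hj o).not_gt
    · exact fun j _ o => Finset.sum_nonneg fun o' _ => hshare j o'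
  | succ n ih =>
    obtain ⟨τ, hτ⟩ := ih
    rw [Function.iterate_succ_apply']
    exact hτ.eatStep hcard hrow

end Phase

/-! ### The outcome of eating one type over all phases -/

section Eating

variable {N E : Type*} [Fintype N] [Fintype E]

/-- `S` is the outcome of simultaneous eating when agent `j` eats in phase `r j`, where `τ k o` is
the time spent in phase `k` before `o` is exhausted. -/
structure IsEating (pref : N → E → E → Prop) (r : N → ℕ) (S : N → E → ℝ) (τ : ℕ → E → ℝ) :
    Prop where
  nonneg : ∀ j o, 0 ≤ S j o
  row : ∀ j, ∑ o, S j o = 1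
  col : ∀ o, ∑ j, S j o = 1
  cum_le : ∀ j o, 0 < S j o → ∑ o' ∈ weakUpper (pref j) o, S j o' ≤ τ (r j) o
  le_cum : ∀ j o, τ (r j) o ≤ ∑ o' ∈ weakUpper (pref j) o, S j o'
  time_eq_one : ∀ k l o, k < l → 0 < τ l o → τ k o = 1

variable {pref : N → E → E → Prop} {r : N → ℕ} {S : N → E → ℝ} {τ : ℕ → E → ℝ}

theorem IsEating.time_pos (h : IsEating pref r S τ) {j : N} {o : E} (ho : 0 < S j o) :
    0 < τ (r j) o := by
  refine lt_of_lt_of_le ho (le_trans ?_ (h.cum_le j o ho))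
  exact Finset.single_le_sum (f := S j) (fun o' _ => h.nonneg j o')
    (mem_weakUpper.2 (Or.inr rfl))

theorem IsEating.sum_le_one (h : IsEating pref r S τ) (j : N) (s : Finset E) :
    ∑ o ∈ s, S j o ≤ 1 := by
  rw [← h.row j]
  exact Finset.sum_le_sum_of_subset_of_nonneg (Finset.subset_univ _) fun o _ _ => h.nonneg j o

/-- Agents that eat in the same phase do not envy each other. -/
theorem IsEating.sum_weakUpper_le [∀ j, IsStrictTotalOrder E (pref j)]
    (h : IsEating pref r S τ) {j k : N} (hjk : r j = r k) (o : E) :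
    ∑ o' ∈ weakUpper (pref j) o, S k o' ≤ ∑ o' ∈ weakUpper (pref j) o, S j o' := by
  set B : Finset E := {o' ∈ weakUpper (pref j) o | 0 < S k o'} with hB
  have hsum : ∑ o' ∈ weakUpper (pref j) o, S k o' = ∑ o' ∈ B, S k o' := by
    rw [hB, Finset.sum_filter]
    refine Finset.sum_congr rfl fun o' _ => ?_
    split_ifs with h0
    · rfl
    · exact le_antisymm (not_lt.1 h0) (h.nonneg k o')
  rw [hsum]
  rcases B.eq_empty_or_nonempty with hB0 | hB0
  · rw [hB0, Finset.sum_empty]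
    exact Finset.sum_nonneg fun o' _ => h.nonneg j o'
  -- All that `k` holds in the upper set was eaten before its worst item `m`, by her own order, ran
  -- out; up to then `j` ate only items at least as good as `m`.
  obtain ⟨m, hm, hworst⟩ := exists_worst (r := pref k) B hB0
  have hm' := Finset.mem_filter.1 hm
  calc ∑ o' ∈ B, S k o' ≤ ∑ o' ∈ weakUpper (pref k) m, S k o' := by
        refine Finset.sum_le_sum_of_subset_of_nonneg (fun q hq => mem_weakUpper.2 ?_)
          fun o' _ _ => h.nonneg k o'
        by_cases e : q = m
        · exact Or.inr e
        · exact Or.inl (hworst q hq e)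
    _ ≤ τ (r k) m := h.cum_le k m hm'.2
    _ = τ (r j) m := by rw [hjk]
    _ ≤ ∑ o' ∈ weakUpper (pref j) m, S j o' := h.le_cum j m
    _ ≤ ∑ o' ∈ weakUpper (pref j) o, S j o' := by
        refine Finset.sum_le_sum_of_subset_of_nonneg (fun q hq => ?_) fun o' _ _ => h.nonneg j o'
        rcases mem_weakUpper.1 hm'.1 with hmo | rfl
        · exact mem_weakUpper.2
            (Or.inl (mem_strictUpper.1 (weakUpper_subset_strictUpper hmo hq)))
        · exact hq

/-- A nonempty strict upper set is the weak upper set of its worst element. -/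
theorem IsEating.sum_strictUpper_le [∀ j, IsStrictTotalOrder E (pref j)]
    (h : IsEating pref r S τ) {j k : N} (hjk : r j = r k) (o : E) :
    ∑ o' ∈ strictUpper (pref j) o, S k o' ≤ ∑ o' ∈ strictUpper (pref j) o, S j o' := by
  rcases (strictUpper (pref j) o).eq_empty_or_nonempty with h0 | h0
  · rw [h0, Finset.sum_empty, Finset.sum_empty]
  obtain ⟨m, hm, hworst⟩ := exists_worst (r := pref j) _ h0
  have hU : strictUpper (pref j) o = weakUpper (pref j) m := by
    refine Finset.Subset.antisymm (fun q hq => mem_weakUpper.2 ?_)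
      (weakUpper_subset_strictUpper (mem_strictUpper.1 hm))
    by_cases e : q = m
    · exact Or.inr e
    · exact Or.inl (hworst q hq e)
  rw [hU]
  exact h.sum_weakUpper_le hjk m

/-- An agent that eats in an earlier phase gets at least as much of the items better than `o` as a
later agent gets of those and `o`. -/
theorem IsEating.sum_weakUpper_le_sum_strictUpper [∀ j, IsStrictTotalOrder E (pref j)]
    (h : IsEating pref r S τ) {j k : N} (hjk : r j < r k) (o : E) :
    ∑ o' ∈ weakUpper (pref j) o, S k o' ≤ ∑ o' ∈ strictUpper (pref j) o, S j o' := by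
  -- An item left for `k` outlasted the phase of `j`, who therefore never ate anything worse.
  have hfull : ∀ q, 0 < S k q → 1 ≤ ∑ o' ∈ weakUpper (pref j) q, S j o' := fun q hq => by
    rw [← h.time_eq_one _ _ q hjk (h.time_pos hq)]
    exact h.le_cum j q
  by_cases hex : ∃ q ∈ strictUpper (pref j) o, 0 < S k q
  · obtain ⟨q, hq, hqk⟩ := hex
    calc _ ≤ 1 := h.sum_le_one k _
      _ ≤ _ := hfull q hqk
      _ ≤ _ := Finset.sum_le_sum_of_subset_of_nonneg
          (weakUpper_subset_strictUpper (mem_strictUpper.1 hq)) fun o' _ _ => h.nonneg j o'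
  · push Not at hex
    have h0 : ∑ o' ∈ strictUpper (pref j) o, S k o' = 0 :=
      Finset.sum_eq_zero fun q hq => le_antisymm (hex q hq) (h.nonneg k q)
    rw [sum_weakUpper, h0, add_zero]
    rcases (h.nonneg k o).eq_or_lt with hk | hk
    · rw [← hk]
      exact Finset.sum_nonneg fun o' _ => h.nonneg j o'
    -- Here `k` holds nothing above `o`; the part of `j`'s unit spent on `o` is at most what `k`
    -- leaves of it.
    · have h1 := hfull o hk
      rw [sum_weakUpper] at h1
      have hne : j ≠ k := fun e => hjk.ne (congrArg r e)
      have h2 : S j o + S k o ≤ 1 := by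
        rw [← h.col o, ← Finset.sum_pair (f := fun i => S i o) hne]
        exact Finset.sum_le_sum_of_subset_of_nonneg (Finset.subset_univ _)
          fun i _ _ => h.nonneg i o
      linarith

/-- If `M` agrees with `S` for the agents eating before phase `k` and weakly dominates it for those
eating in phase `k`, then it agrees with `S` for the latter too. -/
theorem IsEating.eq_of_dominates [∀ j, IsStrictTotalOrder E (pref j)]
    (h : IsEating pref r S τ) {M : N → E → ℝ} (hM : ∀ j o, 0 ≤ M j o)
    (hrow : ∀ j, ∑ o, M j o = 1) (hcol : ∀ o, ∑ j, M j o = 1) {k : ℕ}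
    (hlt : ∀ j, r j < k → ∀ o, M j o = S j o)
    (hdom : ∀ j, r j = k → ∀ o,
      ∑ o' ∈ weakUpper (pref j) o, S j o' ≤ ∑ o' ∈ weakUpper (pref j) o, M j o')
    {j : N} (hj : r j = k) (o : E) : M j o = S j o := by
  have hprev : ∀ i, r i = k → ∀ o, 0 < S i o → ∀ q, pref i q o →
      τ k q < τ k o ∧ τ k q < 1 := by
    intro i hi o ho q hq
    have h1 := h.le_cum i q
    have h2 : ∑ o' ∈ weakUpper (pref i) q, S i o' ≤ ∑ o' ∈ strictUpper (pref i) o, S i o' :=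
      Finset.sum_le_sum_of_subset_of_nonneg (weakUpper_subset_strictUpper hq)
        fun o' _ _ => h.nonneg i o'
    have h3 := h.cum_le i o ho
    have h4 := h.sum_le_one i (weakUpper (pref i) o)
    rw [sum_weakUpper] at h3 h4
    rw [hi] at h1 h3
    constructor <;> linarith
  have hle : ∀ i, r i = k → ∀ o, (∀ q, pref i q o → M i q = S i q) → S i o ≤ M i o := by
    intro i hi o heq
    have h1 := hdom i hi o
    rw [sum_weakUpper, sum_weakUpper,
      Finset.sum_congr rfl fun q hq => heq q (mem_strictUpper.1 hq)] at h1
    linarith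
  -- Induction on exhaustion times: by `hprev`, whatever a phase-`k` agent prefers to an item she
  -- holds ran out strictly earlier.
  have hwf : WellFounded fun o q : E => τ k o < τ k q := by
    have : IsTrans E fun o q => τ k o < τ k q := ⟨fun _ _ _ => lt_trans⟩
    have : Std.Irrefl fun o q : E => τ k o < τ k q := ⟨fun _ => lt_irrefl _⟩
    exact Finite.wellFounded_of_trans_of_irrefl _
  -- An item gone before the end of the phase has no later holders, so `S ≤ M` on its whole column,
  -- and equal column sums force equality.
  have hexh : ∀ o, τ k o < 1 → ∀ i, M i o = S i o := by
    intro o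
    induction o using hwf.induction with
    | _ o ih =>
      intro ho i
      refine ((Finset.sum_eq_sum_iff_of_le (f := fun i => S i o) (g := fun i => M i o)
        fun i _ => ?_).1 ((h.col o).trans (hcol o).symm) i (Finset.mem_univ i)).symm
      rcases (h.nonneg i o).eq_or_lt with h0 | h0
      · exact h0 ▸ hM i o
      · rcases lt_trichotomy (r i) k with hi | hi | hi
        · exact (hlt i hi o).ge
        · refine hle i hi o fun q hq => ?_
          obtain ⟨h1, h2⟩ := hprev i hi o h0 q hq
          exact ih q h1 h2 i
        · exact absurd (h.time_eq_one k _ o hi (h.time_pos h0)) ho.ne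
  -- Items that last to the end may have later holders, so now the row of `j` is compared instead of
  -- columns.
  have hall : ∀ o, S j o ≤ M j o := by
    intro o
    rcases (h.nonneg j o).eq_or_lt with h0 | h0
    · rw [← h0]
      exact hM j o
    · exact hle j hj o fun q hq => hexh q (hprev j hj o h0 q hq).2 j
  exact ((Finset.sum_eq_sum_iff_of_le fun o _ => hall o).1
    ((h.row j).trans (hrow j).symm) o (Finset.mem_univ o)).symm

end Eating

/-! ### Types and ranks -/

section Rank

variable {p : ℕ} {D : Fin p → Type*} (L : LexOrder D)

theorem LexOrder.rank_lt_rank {i i' : Fin p} (h : L.imp i i') : L.rank i < L.rank i' := by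
  have := L.imp_order
  refine Finset.card_lt_card (Finset.ssubset_iff_of_subset ?_ |>.2 ⟨i, ?_, ?_⟩)
  · intro q hq
    simp only [Finset.mem_filter, Finset.mem_univ, true_and] at hq ⊢
    exact trans_of L.imp hq h
  · simpa using h
  · simpa using irrefl_of L.imp i

theorem LexOrder.rank_injective : Function.Injective L.rank := by
  have := L.imp_order
  intro i i' h
  rcases trichotomous_of L.imp i i' with h1 | h1 | h1
  · exact absurd h (L.rank_lt_rank h1).ne
  · exact h1
  · exact absurd h (L.rank_lt_rank h1).ne'

theorem LexOrder.rank_lt_rank_iff {i i' : Fin p} : L.rank i < L.rank i' ↔ L.imp i i' := by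
  have := L.imp_order
  refine ⟨fun h => ?_, L.rank_lt_rank⟩
  rcases trichotomous_of L.imp i i' with h1 | h1 | h1
  · exact h1
  · exact absurd (congrArg L.rank h1) h.ne
  · exact absurd (L.rank_lt_rank h1) h.not_gt

theorem LexOrder.rank_lt (i : Fin p) : L.rank i < p := by
  have := L.imp_order
  conv_rhs => rw [← Fintype.card_fin p, ← Finset.card_univ]
  refine Finset.card_lt_card (Finset.ssubset_iff_of_subset (Finset.subset_univ _) |>.2
    ⟨i, Finset.mem_univ i, ?_⟩)
  simpa using irrefl_of L.imp i

end Rank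

/-! ### LexiPS as eating -/

section Mechanism

variable {p : ℕ} {N : Type*} [Fintype N] {D : Fin p → Type*} [∀ i, Fintype (D i)]

theorem lexiPSLoop_succ (L : N → LexOrder D) (k : ℕ) (i : Fin p) :
    lexiPSLoop L (k + 1) i =
      ((eatPhase {j | (L j).rank i = k} (fun j => (L j).item i) (lexiPSLoop L k i).1
          (lexiPSLoop L k i).2).supply,
        (eatPhase {j | (L j).rank i = k} (fun j => (L j).item i) (lexiPSLoop L k i).1
          (lexiPSLoop L k i).2).share) := rfl

/-- The invariant of the outer loop of LexiPS. -/
structure LoopInv (L : N → LexOrder D) (k : ℕ) (i : Fin p) : Prop where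
  supply_nonneg : ∀ o, 0 ≤ (lexiPSLoop L k i).1 o
  share_nonneg : ∀ j o, 0 ≤ (lexiPSLoop L k i).2 j o
  col : ∀ o, (lexiPSLoop L k i).1 o + ∑ j, (lexiPSLoop L k i).2 j o = 1
  row : ∀ j, ∑ o, (lexiPSLoop L k i).2 j o = if (L j).rank i < k then 1 else 0

variable {L : N → LexOrder D}

theorem LoopInv.exists_eatInv (hcard : ∀ i, Fintype.card (D i) = Fintype.card N) {k : ℕ}
    {i : Fin p} (h : LoopInv L k i) :
    ∃ τ, EatInv {j | (L j).rank i = k} (fun j => (L j).item i) (lexiPSLoop L k i).1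
      (lexiPSLoop L k i).2 (eatPhase {j | (L j).rank i = k} (fun j => (L j).item i)
        (lexiPSLoop L k i).1 (lexiPSLoop L k i).2) τ := by
  have := fun j => (L j).item_order i
  refine exists_eatInv_eatPhase (hcard i) h.supply_nonneg h.share_nonneg h.col ?_ ?_
  · intro j hj o
    have hr := h.row j
    rw [if_neg (by simpa using (Finset.mem_filter.1 hj).2.ge),
      Finset.sum_eq_zero_iff_of_nonneg fun o _ => h.share_nonneg j o] at hr
    exact hr o (Finset.mem_univ o)
  · intro j _
    rw [h.row j]
    split_ifs <;> norm_num

theorem loopInv (hcard : ∀ i, Fintype.card (D i) = Fintype.card N) (k : ℕ) (i : Fin p) :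
    LoopInv L k i := by
  induction k with
  | zero => exact ⟨by simp [lexiPSLoop], by simp [lexiPSLoop], by simp [lexiPSLoop],
      by simp [lexiPSLoop]⟩
  | succ k ih =>
    obtain ⟨τ, hτ⟩ := ih.exists_eatInv hcard
    refine ⟨hτ.supply_nonneg, hτ.share_nonneg, hτ.col, fun j => ?_⟩
    rw [lexiPSLoop_succ]
    dsimp only
    by_cases hj : (L j).rank i = k
    · rw [hτ.row j (by simpa using hj), eatPhase_timer, if_pos (by omega)]
    · rw [hτ.frozen j (by simpa using hj), ih.row j]
      congr 1
      rw [eq_iff_iff]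
      omega

theorem exists_isEating_lexiPSItem (hcard : ∀ i, Fintype.card (D i) = Fintype.card N)
    (i : Fin p) :
    ∃ τ, IsEating (fun j => (L j).item i) (fun j => (L j).rank i) (lexiPSItem L i) τ := by
  choose τ hτ using fun k => (loopInv (L := L) hcard k i).exists_eatInv hcard
  -- Index `k` is the state before phase `k`, so the final shares of `j` are those at index `rank +
  -- 1`.
  have hfix : ∀ j k, (L j).rank i < k → (lexiPSLoop L k i).2 j =
      (lexiPSLoop L ((L j).rank i + 1) i).2 j := by
    intro j k hk
    induction k, hk using Nat.le_induction with
    | base => rfl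
    | succ k hk ih =>
      rw [← ih]
      exact (hτ k).frozen j (by simpa using (Nat.lt_of_succ_le hk).ne)
  have hitem : ∀ j, lexiPSItem L i j = (lexiPSLoop L ((L j).rank i + 1) i).2 j := fun j =>
    hfix j p ((L j).rank_lt i)
  have hanti : ∀ o, Antitone fun k => (lexiPSLoop L k i).1 o := fun o =>
    antitone_nat_of_succ_le fun k => (hτ k).supply_le o
  have hinv := loopInv (L := L) hcard p i
  have hrow : ∀ j, ∑ o, lexiPSItem L i j o = 1 := fun j =>
    (hinv.row j).trans (if_pos ((L j).rank_lt i))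
  refine ⟨τ, hinv.share_nonneg, hrow, fun o => ?_, fun j o ho => ?_, fun j o => ?_,
    fun k l o hkl ho => ?_⟩
  -- Column sums are at most one and total `|N| = |D i|`, so each equals one.
  · have h1 : ∑ o, ∑ j, lexiPSItem L i j o = ∑ _o : D i, (1 : ℝ) := by
      rw [Finset.sum_comm, Finset.sum_congr rfl fun j _ => hrow j]
      simp [hcard i]
    refine (Finset.sum_eq_sum_iff_of_le fun o _ => ?_).1 h1 o (Finset.mem_univ o)
    have := hinv.col o
    have := hinv.supply_nonneg o
    unfold lexiPSItem
    linarith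
  · rw [hitem] at ho ⊢
    exact (hτ _).cum_le j (by simp) o ho
  · rw [hitem]
    exact (hτ _).le_cum j (by simp) o
  · have h1 : 0 < (lexiPSLoop L (k + 1) i).1 o :=
      ((hτ l).time_pos o ho).trans_le (hanti o hkl)
    rw [(hτ k).time_eq o h1, eatPhase_timer]

end Mechanism

/-! ### Products of marginals -/

section Product

variable {p : ℕ} {N : Type*} [Fintype N] {D : Fin p → Type*} [∀ i, Fintype (D i)]

theorem sum_prod_eq_one {q : ∀ i, D i → ℝ} (hq : ∀ i, ∑ o, q i o = 1) :
    ∑ x : Bundle D, ∏ i, q i (x i) = 1 := by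
  have h := Finset.prod_univ_sum (fun i => (Finset.univ : Finset (D i))) q
  rw [Fintype.piFinset_univ] at h
  rw [← h, Finset.prod_eq_one fun i _ => hq i]

theorem sum_prod_filter_eq {q : ∀ i, D i → ℝ} (hq : ∀ i, ∑ o, q i o = 1) (i : Fin p) (o : D i) :
    ∑ x : Bundle D with x i = o, ∏ i', q i' (x i') = q i o := by
  have hset : ({x : Bundle D | x i = o} : Finset (Bundle D)) =
      Fintype.piFinset (Function.update (fun i' => (Finset.univ : Finset (D i'))) i {o}) := by
    ext x
    simp only [Finset.mem_filter, Finset.mem_univ, true_and, Fintype.mem_piFinset]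
    refine ⟨fun h i' => ?_, fun h => by simpa using h i⟩
    by_cases e : i' = i
    · subst e
      simpa using h
    · simp [e]
  rw [hset, ← Finset.prod_univ_sum, Finset.prod_eq_single i]
  · simp
  · intro i' _ e
    simp [e, hq]
  · simp

theorem isFractionalAssignment_prod {S : ∀ i, N → D i → ℝ} (hS : ∀ i j o, 0 ≤ S i j o)
    (hrow : ∀ i j, ∑ o, S i j o = 1) (hcol : ∀ i o, ∑ j, S i j o = 1) :
    IsFractionalAssignment fun j (x : Bundle D) => ∏ i, S i j (x i) := by
  have h0 : ∀ j (x : Bundle D), 0 ≤ ∏ i, S i j (x i) := fun j x =>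
    Finset.prod_nonneg fun i _ => hS i j (x i)
  have h1 : ∀ j, ∑ x : Bundle D, ∏ i, S i j (x i) = 1 := fun j =>
    sum_prod_eq_one fun i => hrow i j
  refine ⟨h0, fun j x => ?_, h1, fun i o => ?_⟩
  · rw [← h1 j]
    exact Finset.single_le_sum (f := fun x : Bundle D => ∏ i, S i j (x i))
      (fun x _ => h0 j x) (Finset.mem_univ x)
  · rw [← hcol i o]
    exact Finset.sum_congr rfl fun j _ => sum_prod_filter_eq (q := fun i => S i j)
      (fun i => hrow i j) i o

/-- A product of doubly stochastic matrices is decomposable. -/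
theorem isDecomposable_prod (hcard : ∀ i, Fintype.card (D i) = Fintype.card N)
    {S : ∀ i, N → D i → ℝ} (hS : ∀ i j o, 0 ≤ S i j o)
    (hrow : ∀ i j, ∑ o, S i j o = 1) (hcol : ∀ i o, ∑ j, S i j o = 1) :
    IsDecomposable fun j (x : Bundle D) => ∏ i, S i j (x i) := by
  let e : ∀ i, D i ≃ N := fun i => Fintype.equivOfCardEq (hcard i)
  have hbirk : ∀ i, ∃ w : Equiv.Perm N → ℝ, (∀ σ, 0 ≤ w σ) ∧ ∑ σ, w σ = 1 ∧
      ∀ j o, S i j o = ∑ σ, w σ * if σ j = e i o then 1 else 0 := by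
    intro i
    have hmem : (Matrix.of fun j k => S i j ((e i).symm k)) ∈ doublyStochastic ℝ N := by
      rw [mem_doublyStochastic_iff_sum]
      refine ⟨fun j k => hS i j _, fun j => ?_, fun k => hcol i _⟩
      rw [← hrow i j]
      exact Equiv.sum_comp (e i).symm fun o => S i j o
    obtain ⟨w, hw0, hw1, hw⟩ := exists_eq_sum_perm_of_mem_doublyStochastic hmem
    refine ⟨w, hw0, hw1, fun j o => ?_⟩
    have h := congrFun (congrFun hw j) (e i o)
    simp only [Matrix.of_apply, Equiv.symm_apply_apply] at h
    rw [← h, Matrix.sum_apply]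
    refine Finset.sum_congr rfl fun σ _ => ?_
    simp [Matrix.smul_apply, Equiv.Perm.permMatrix, PEquiv.toMatrix_apply]
  choose w hw0 hw1 hw using hbirk
  -- Expanding the product of sums gives one term for each choice of a permutation per type.
  have hexp : (fun j (x : Bundle D) => ∏ i, S i j (x i)) =
      ∑ σ : Fin p → Equiv.Perm N, (∏ i, w i (σ i)) •
        fun j (x : Bundle D) => ∏ i, if σ i j = e i (x i) then (1 : ℝ) else 0 := by
    funext j x
    simp only [Finset.sum_apply, Pi.smul_apply, smul_eq_mul, ← Finset.prod_mul_distrib]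
    rw [Finset.prod_congr rfl fun i _ => hw i j (x i),
      Finset.prod_univ_sum (fun _ => Finset.univ)
        fun i σ => w i σ * if σ j = e i (x i) then (1 : ℝ) else 0,
      Fintype.piFinset_univ]
  have hsum : ∑ σ : Fin p → Equiv.Perm N, ∏ i, w i (σ i) = 1 := by
    have h := Finset.prod_univ_sum (fun _ : Fin p => (Finset.univ : Finset (Equiv.Perm N))) w
    rw [Fintype.piFinset_univ] at h
    rw [← h, Finset.prod_eq_one fun i _ => hw1 i]
  unfold IsDecomposable
  rw [hexp]
  refine (convex_convexHull ℝ _).sum_mem (fun σ _ => Finset.prod_nonneg fun i _ => hw0 i _) hsum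
    fun σ _ => subset_convexHull ℝ _ ⟨isFractionalAssignment_prod
      (S := fun i j o => if σ i j = e i o then (1 : ℝ) else 0) ?_ ?_ ?_, ?_⟩
  · intro i j o
    split_ifs <;> norm_num
  · intro i j
    rw [Finset.sum_eq_single ((e i).symm (σ i j))]
    · simp
    · intro o _ ho
      exact if_neg fun h => ho (by simp [h])
    · simp
  · intro i o
    rw [Finset.sum_eq_single ((σ i).symm (e i o))]
    · simp
    · intro j _ hj
      exact if_neg fun h => hj (by simp [← h])
    · simp
  · intro j x
    dsimp only
    rw [Finset.prod_boole]
    split_ifs <;> simp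

end Product

/-! ### Lexicographic sums -/

section LexSum

variable {ι : Type*}

/-- The probability that an independent tuple is lexicographically at least as good as a given one,
if its entry `i` is better with probability `a i` and equal with probability `b i`. -/
def lexSum (r : ι → ℕ) (a b : ι → ℝ) (s : Finset ι) : ℝ :=
  ∑ i ∈ s, a i * ∏ i' ∈ s with r i' < r i, b i' + ∏ i ∈ s, b i

/-- Condition on the most important coordinate: it is better, or it ties and the others decide. -/
theorem lexSum_insert {r : ι → ℕ} {a b : ι → ℝ} {s : Finset ι} {i : ι} (hi : i ∉ s)
    (hr : ∀ i' ∈ s, r i < r i') :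
    lexSum r a b (insert i s) = a i + b i * lexSum r a b s := by
  unfold lexSum
  rw [Finset.sum_insert hi, Finset.prod_insert hi, mul_add, Finset.mul_sum, ← add_assoc]
  congr 2
  · rw [Finset.filter_eq_empty_iff.2, Finset.prod_empty, mul_one]
    intro i' hi'
    rcases Finset.mem_insert.1 hi' with rfl | hi'
    · exact lt_irrefl _
    · exact (hr i' hi').not_gt
  · refine Finset.sum_congr rfl fun i' hi' => ?_
    rw [Finset.filter_insert, if_pos (hr i' hi'), Finset.prod_insert]
    · ring
    · exact fun h => hi (Finset.mem_filter.1 h).1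

theorem lexSum_mem_Icc {r : ι → ℕ} (hr : Function.Injective r) {a b : ι → ℝ}
    (ha : ∀ i, 0 ≤ a i) (hb : ∀ i, 0 ≤ b i) (hab : ∀ i, a i + b i ≤ 1) (s : Finset ι) :
    lexSum r a b s ∈ Set.Icc (0 : ℝ) 1 := by
  induction s using Finset.induction_on_min_value r with
  | empty => simp [lexSum]
  | insert i s hi hmin ih =>
    rw [lexSum_insert hi fun i' hi' => (hmin i' hi').lt_of_ne
      fun e => hi (hr e ▸ hi')]
    have := ha i
    have := hb i
    have := hab i
    constructor <;> nlinarith [ih.1, ih.2]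

/-- Peel off the most important coordinate. If `a' + b' ≤ a` there, the bounds `0` and `1` on the
remaining sums suffice; otherwise it is no witness `l`, and the hypothesis passes to the other
coordinates. -/
theorem lexSum_le_lexSum {r : ι → ℕ} (hr : Function.Injective r) {a b a' b' : ι → ℝ}
    (ha : ∀ i, 0 ≤ a i) (hb : ∀ i, 0 ≤ b i) (hab : ∀ i, a i + b i ≤ 1)
    (ha' : ∀ i, 0 ≤ a' i) (hb' : ∀ i, 0 ≤ b' i) (hab' : ∀ i, a' i + b' i ≤ 1) (s : Finset ι)
    (h : ∀ i ∈ s, (a' i ≤ a i ∧ a' i + b' i ≤ a i + b i) ∨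
      ∃ l ∈ s, r l ≤ r i ∧ a' l + b' l ≤ a l) :
    lexSum r a' b' s ≤ lexSum r a b s := by
  induction s using Finset.induction_on_min_value r with
  | empty => simp [lexSum]
  | insert i s hi hmin ih =>
    have hlt : ∀ i' ∈ s, r i < r i' := fun i' hi' => (hmin i' hi').lt_of_ne
      fun e => hi (hr e ▸ hi')
    rw [lexSum_insert hi hlt, lexSum_insert hi hlt]
    obtain ⟨h0, h1⟩ := lexSum_mem_Icc hr ha hb hab s
    obtain ⟨h0', h1'⟩ := lexSum_mem_Icc hr ha' hb' hab' s
    have hbi := hb i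
    have hbi' := hb' i
    by_cases hstrong : a' i + b' i ≤ a i
    · have := mul_le_mul_of_nonneg_left h1' hbi'
      have := mul_nonneg hbi h0
      linarith
    · obtain ⟨hw1, hw2⟩ : a' i ≤ a i ∧ a' i + b' i ≤ a i + b i := by
        refine (h i (Finset.mem_insert_self i s)).resolve_right ?_
        rintro ⟨l, hl, hli, hl'⟩
        rcases Finset.mem_insert.1 hl with rfl | hl
        · exact hstrong hl'
        · exact (hlt l hl).not_ge hli
      have hs := ih fun i' hi' => by
        rcases h i' (Finset.mem_insert_of_mem hi') with h2 | ⟨l, hl, hli, hl'⟩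
        · exact Or.inl h2
        · rcases Finset.mem_insert.1 hl with rfl | hl
          · exact absurd hl' hstrong
          · exact Or.inr ⟨l, hl, hli, hl'⟩
      -- With `x` the unprimed sum over `s`, `(a - a') + (b - b') x = (a - a')(1 - x) + (a + b - a'
      -- - b') x`.
      have e1 := mul_le_mul_of_nonneg_left hs hbi'
      have e2 := mul_nonneg (sub_nonneg.2 hw1) (sub_nonneg.2 h1)
      have e3 := mul_nonneg (sub_nonneg.2 hw2) h0
      linarith

end LexSum

/-! ### Envy-freeness -/

section Envy

variable {p : ℕ} {N : Type*} [Fintype N] {D : Fin p → Type*} [∀ i, Fintype (D i)]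

theorem LexOrder.Represents.iff_rank {L : LexOrder D} {R : Bundle D → Bundle D → Prop}
    (hL : L.Represents R) (x y : Bundle D) :
    R x y ↔ ∃ i, L.item i (x i) (y i) ∧ ∀ i', L.rank i' < L.rank i → x i' = y i' := by
  simp only [hL x y, L.rank_lt_rank_iff]

/-- Besides `x`, the upper contour set is a disjoint union of boxes `t i`, indexed by the deciding
type `i`; a product measure factors on each box. -/
theorem sum_upperContour_prod {L : LexOrder D} {R : Bundle D → Bundle D → Prop}
    (hL : L.Represents R) {q : ∀ i, D i → ℝ} (hq : ∀ i, ∑ o, q i o = 1) (x : Bundle D) :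
    ∑ y ∈ upperContour R x, ∏ i, q i (y i) =
      lexSum L.rank (fun i => ∑ o ∈ strictUpper (L.item i) (x i), q i o) (fun i => q i (x i))
        Finset.univ := by
  have hitem := L.item_order
  let t : Fin p → ∀ i', Finset (D i') := fun i i' =>
    if L.rank i' < L.rank i then {x i'} else
      if i' = i then strictUpper (L.item i') (x i') else Finset.univ
  have ht : ∀ i y, y ∈ Fintype.piFinset (t i) ↔
      L.item i (y i) (x i) ∧ ∀ i', L.rank i' < L.rank i → y i' = x i' := by
    intro i y
    simp only [Fintype.mem_piFinset, t]
    refine ⟨fun h => ⟨?_, fun i' hi' => ?_⟩, fun h i' => ?_⟩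
    · simpa [mem_strictUpper] using h i
    · simpa [hi'] using h i'
    · split_ifs with h1 h2
      · simpa using h.2 i' h1
      · subst h2
        exact mem_strictUpper.2 h.1
      · exact Finset.mem_univ _
  have hset : upperContour R x =
      (Finset.univ.biUnion fun i => Fintype.piFinset (t i)) ∪ {x} := by
    ext y
    simp only [upperContour, Finset.mem_filter, Finset.mem_univ, true_and, Finset.mem_union,
      Finset.mem_biUnion, Finset.mem_singleton, ht, hL.iff_rank]
  have hdisj : Disjoint (Finset.univ.biUnion fun i => Fintype.piFinset (t i)) {x} := by
    rw [Finset.disjoint_singleton_right, Finset.mem_biUnion]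
    rintro ⟨i, _, hi⟩
    exact irrefl_of (L.item i) _ ((ht i x).1 hi).1
  have hlt : ∀ i i' y, y ∈ Fintype.piFinset (t i) → y ∈ Fintype.piFinset (t i') →
      ¬ L.rank i < L.rank i' := by
    intro i i' y h h' hlt
    have h1 := ((ht i y).1 h).1
    rw [((ht i' y).1 h').2 i hlt] at h1
    exact irrefl_of (L.item i) _ h1
  rw [hset, Finset.sum_union hdisj, Finset.sum_singleton, Finset.sum_biUnion]
  · unfold lexSum
    congr 1
    refine Finset.sum_congr rfl fun i _ => ?_
    rw [← Finset.prod_univ_sum]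
    have hfac : ∀ i', ∑ o ∈ t i i', q i' o = if L.rank i' < L.rank i then q i' (x i') else
        if i' = i then ∑ o ∈ strictUpper (L.item i') (x i'), q i' o else 1 := by
      intro i'
      simp only [t]
      split_ifs
      · simp
      · rfl
      · exact hq i'
    rw [Finset.prod_congr rfl fun i' _ => hfac i', Finset.prod_ite, mul_comm]
    congr 1
    rw [Finset.prod_ite_eq', if_pos (by simp)]
  · intro i _ i' _ hne
    rw [Function.onFun, Finset.disjoint_left]
    intro y h h'
    rcases lt_trichotomy (L.rank i) (L.rank i') with h1 | h1 | h1
    · exact hlt i i' y h h' h1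
    · exact hne (L.rank_injective h1)
    · exact hlt i' i y h' h h1

theorem LexOrder.exists_rank_eq (L : LexOrder D) {k : ℕ} (hk : k < p) : ∃ i, L.rank i = k := by
  have hinj : Function.Injective fun i => (⟨L.rank i, L.rank_lt i⟩ : Fin p) := fun i i' h =>
    L.rank_injective (Fin.mk.inj h)
  obtain ⟨i, hi⟩ := Finite.injective_iff_surjective.1 hinj ⟨k, hk⟩
  exact ⟨i, Fin.mk.inj hi⟩

/-- If two importance orders rank `i` differently, the first one ranks some type that it considers
at least as important as `i` above the position that the second one gives it. -/
theorem LexOrder.exists_rank_lt_rank (L L' : LexOrder D) {i : Fin p} (hi : L.rank i ≠ L'.rank i) :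
    ∃ l, L.rank l ≤ L.rank i ∧ L.rank l < L'.rank l := by
  by_contra! hcon
  -- Without such a type, ranks under `L'` can only drop, but by induction all lower positions are
  -- already taken.
  have heq : ∀ m l, L.rank l = m → L.rank l ≤ L.rank i → L'.rank l = L.rank l := by
    intro m
    induction m using Nat.strong_induction_on with
    | _ m ih =>
      intro l hl hli
      refine (hcon l hli).eq_of_not_lt fun hlt => ?_
      obtain ⟨l', hl'⟩ := L.exists_rank_eq (L'.rank_lt l)
      have h1 := ih _ (hl ▸ hl' ▸ hlt) l' rfl (by omega)
      have h2 : l' = l := L'.rank_injective (h1.trans hl')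
      subst h2
      omega
  exact hi (heq _ i rfl le_rfl).symm

theorem isSdEnvyFree_lexiPS (hcard : ∀ i, Fintype.card (D i) = Fintype.card N)
    {R : N → Bundle D → Bundle D → Prop} {L : N → LexOrder D}
    (hL : ∀ j, (L j).Represents (R j)) : IsSdEnvyFree R (lexiPS L) := by
  choose τ hτ using fun i => exists_isEating_lexiPSItem (L := L) hcard i
  have hitem := fun i j => (L j).item_order i
  intro j k x
  unfold lexiPS
  rw [sum_upperContour_prod (hL j) (q := fun i => lexiPSItem L i k) fun i => (hτ i).row k,
    sum_upperContour_prod (hL j) (q := fun i => lexiPSItem L i j) fun i => (hτ i).row j]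
  have hab : ∀ j' i, ∑ o ∈ strictUpper ((L j).item i) (x i), lexiPSItem L i j' o +
      lexiPSItem L i j' (x i) =
        ∑ o ∈ weakUpper ((L j).item i) (x i), lexiPSItem L i j' o := fun j' i => by
    rw [sum_weakUpper, add_comm]
  refine lexSum_le_lexSum (L j).rank_injective
    (fun i => Finset.sum_nonneg fun o _ => (hτ i).nonneg j o) (fun i => (hτ i).nonneg j _)
    (fun i => (hab j i).trans_le ((hτ i).sum_le_one j _))
    (fun i => Finset.sum_nonneg fun o _ => (hτ i).nonneg k o) (fun i => (hτ i).nonneg k _)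
    (fun i => (hab k i).trans_le ((hτ i).sum_le_one k _)) _ fun i _ => ?_
  by_cases hi : (L j).rank i = (L k).rank i
  · left
    rw [hab, hab]
    exact ⟨(hτ i).sum_strictUpper_le hi _, (hτ i).sum_weakUpper_le hi _⟩
  · obtain ⟨l, hl, hlt⟩ := (L j).exists_rank_lt_rank (L k) hi
    refine Or.inr ⟨l, Finset.mem_univ l, hl, ?_⟩
    rw [hab]
    exact (hτ l).sum_weakUpper_le_sum_strictUpper hlt _

end Envy

/-! ### Efficiency -/

section Fiber

variable {α : Type*} {s : Finset α} (t : Setoid α) {d : α → ℝ}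

theorem sum_fiber_eq (x : α) :
    ∑ y ∈ s with (Quotient.mk t y) = Quotient.mk t x, d y = ∑ y ∈ s with t y x, d y := by
  simp only [Quotient.eq]

theorem sum_eq_zero_of_fibers (h : ∀ x ∈ s, ∑ y ∈ s with t y x, d y = 0) :
    ∑ x ∈ s, d x = 0 := by
  rw [← Finset.sum_fiberwise_of_maps_to
    (fun x hx => Finset.mem_image_of_mem (Quotient.mk t) hx) d]
  refine Finset.sum_eq_zero fun b hb => ?_
  obtain ⟨x, hx, rfl⟩ := Finset.mem_image.1 hb
  rw [sum_fiber_eq]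
  exact h x hx

theorem sum_nonneg_of_fibers (h : ∀ x ∈ s, 0 ≤ ∑ y ∈ s with t y x, d y) :
    0 ≤ ∑ x ∈ s, d x := by
  rw [← Finset.sum_fiberwise_of_maps_to
    (fun x hx => Finset.mem_image_of_mem (Quotient.mk t) hx) d]
  refine Finset.sum_nonneg fun b hb => ?_
  obtain ⟨x, hx, rfl⟩ := Finset.mem_image.1 hb
  rw [sum_fiber_eq]
  exact h x hx

theorem fiber_sum_eq_zero (h : ∀ x ∈ s, 0 ≤ ∑ y ∈ s with t y x, d y)
    (h0 : ∑ x ∈ s, d x = 0) {x : α} (hx : x ∈ s) : ∑ y ∈ s with t y x, d y = 0 := by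
  rw [← Finset.sum_fiberwise_of_maps_to
    (fun x hx => Finset.mem_image_of_mem (Quotient.mk t) hx) d,
    Finset.sum_eq_zero_iff_of_nonneg] at h0
  · rw [← sum_fiber_eq]
    exact h0 _ (Finset.mem_image_of_mem _ hx)
  · intro b hb
    obtain ⟨x, hx, rfl⟩ := Finset.mem_image.1 hb
    rw [sum_fiber_eq]
    exact h x hx

end Fiber

/-! ### Signed sums over bundles with a common prefix of important types -/

section Prefix

variable {p : ℕ} {D : Fin p → Type*} [∀ i, Fintype (D i)]

/-- Two bundles agree if they contain the same items of the `k` most important types. -/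
def LexOrder.agree (L : LexOrder D) (k : ℕ) : Setoid (Bundle D) where
  r y x := ∀ i, L.rank i < k → y i = x i
  iseqv := ⟨fun _ _ _ => rfl, fun h i hi => (h i hi).symm,
    fun h h' i hi => (h i hi).trans (h' i hi)⟩

theorem LexOrder.agree_iff {L : LexOrder D} {k : ℕ} {x y : Bundle D} :
    L.agree k y x ↔ ∀ i, L.rank i < k → y i = x i := Iff.rfl

theorem LexOrder.agree_update {L : LexOrder D} {i : Fin p} (x y : Bundle D) (o : D i) :
    L.agree (L.rank i) y (Function.update x i o) ↔ L.agree (L.rank i) y x := by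
  refine forall₂_congr fun i' hi' => ?_
  rw [Function.update_of_ne]
  rintro rfl
  exact lt_irrefl _ hi'

variable {L : LexOrder D} {R : Bundle D → Bundle D → Prop} {d : Bundle D → ℝ}

/-- A set determined by the first `k` types is a union of classes of `L.agree k`. -/
theorem sum_filter_eq_zero_of_prefix {k : ℕ}
    (h0 : ∀ x, ∑ y with L.agree k y x, d y = 0) {B : Bundle D → Prop} [DecidablePred B]
    (hB : ∀ x y, L.agree k y x → B x → B y) : ∑ y with B y, d y = 0 := by
  refine sum_eq_zero_of_fibers (L.agree k) fun x hx => ?_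
  rw [← h0 x, Finset.filter_filter]
  congr 1
  ext y
  simp only [Finset.mem_filter, Finset.mem_univ, true_and] at hx ⊢
  exact ⟨fun h => h.2, fun h => ⟨hB x y h hx, h⟩⟩

/-- Dominance carries over to the next type, conditionally on the more important ones. -/
theorem sum_prefix_weakUpper_nonneg (hL : L.Represents R)
    (hd : ∀ x, 0 ≤ ∑ y ∈ upperContour R x, d y) {i : Fin p}
    (h0 : ∀ x, ∑ y with L.agree (L.rank i) y x, d y = 0)
    (x : Bundle D) :
    0 ≤ ∑ y with L.agree (L.rank i) y x ∧
      y i ∈ weakUpper (L.item i) (x i), d y := by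
  have hitem := L.item_order
  have hworst : ∀ i', ∃ w : D i', ∀ o, o ≠ w → L.item i' o w := fun i' => by
    obtain ⟨w, -, hw⟩ := exists_worst (r := L.item i') Finset.univ ⟨x i', Finset.mem_univ _⟩
    exact ⟨w, fun o => hw o (Finset.mem_univ o)⟩
  choose w hw using hworst
  -- With worst items after type `i`, the upper contour set of `z` consists of the bundles that beat
  -- `x` before `i` (the set `B` below, of total zero by `h0`) and exactly the bundles in the goal.
  let z : Bundle D := fun i' => if L.rank i' ≤ L.rank i then x i' else w i'
  have hz : ∀ i', L.rank i' ≤ L.rank i → z i' = x i' := fun i' hi' => if_pos hi'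
  have hzw : ∀ i', ¬ L.rank i' ≤ L.rank i → z i' = w i' := fun i' hi' => if_neg hi'
  obtain ⟨B, hB⟩ : ∃ B : Bundle D → Prop, ∀ y, B y ↔ ∃ i', L.rank i' < L.rank i ∧
      L.item i' (y i') (x i') ∧ ∀ l, L.rank l < L.rank i' → y l = x l := ⟨_, fun _ => Iff.rfl⟩
  have hB0 : ∑ y with B y, d y = 0 := by
    refine sum_filter_eq_zero_of_prefix h0 fun y y' hyy' => ?_
    simp only [hB]
    rintro ⟨i', hi', h1, h2⟩
    rw [L.agree_iff] at hyy'
    refine ⟨i', hi', ?_, fun l hl => ?_⟩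
    · rwa [hyy' i' hi']
    · rw [hyy' l (hl.trans hi'), h2 l hl]
  have hsplit := Finset.sum_filter_add_sum_filter_not (upperContour R z) B d
  have h1 : {y ∈ upperContour R z | B y} = ({y | B y} : Finset (Bundle D)) := by
    ext y
    simp only [upperContour, Finset.mem_filter, Finset.mem_univ, true_and, and_iff_right_iff_imp, hB]
    rintro ⟨i', hi', h1, h2⟩
    refine Or.inl ((hL.iff_rank y z).2 ⟨i', ?_, fun l hl => ?_⟩)
    · rwa [hz i' hi'.le]
    · rw [hz l (hl.trans hi').le, h2 l hl]
  have h2 : {y ∈ upperContour R z | ¬ B y} =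
      ({y | L.agree (L.rank i) y x ∧
        y i ∈ weakUpper (L.item i) (x i)} : Finset (Bundle D)) := by
    ext y
    simp only [upperContour, Finset.mem_filter, Finset.mem_univ, true_and, L.agree_iff,
      mem_weakUpper, hB]
    constructor
    · rintro ⟨hy | rfl, hyB⟩
      · obtain ⟨i', hi1, hi2⟩ := (hL.iff_rank y z).1 hy
        rcases lt_trichotomy (L.rank i') (L.rank i) with h | h | h
        · refine absurd ⟨i', h, ?_, fun l hl => ?_⟩ hyB
          · rwa [← hz i' h.le]
          · rw [hi2 l hl, hz l (hl.trans h).le]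
        · obtain rfl := L.rank_injective h
          refine ⟨fun l hl => (hi2 l hl).trans (hz l hl.le), Or.inl ?_⟩
          rwa [← hz i' le_rfl]
        · exact ⟨fun l hl => (hi2 l (hl.trans h)).trans (hz l hl.le),
            Or.inr ((hi2 i h).trans (hz i le_rfl))⟩
      · exact ⟨fun l hl => hz l hl.le, Or.inr (hz i le_rfl)⟩
    · rintro ⟨hy, hyi⟩
      refine ⟨?_, ?_⟩
      · by_cases hyz : y = z
        · exact Or.inr hyz
        have hne : ({l | y l ≠ z l} : Finset (Fin p)).Nonempty := by
          obtain ⟨l, hl⟩ := Function.ne_iff.1 hyz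
          exact ⟨l, by simpa using hl⟩
        obtain ⟨m, hm, hmin⟩ := Finset.exists_min_image _ L.rank hne
        have hm' : y m ≠ z m := by simpa using hm
        refine Or.inl ((hL.iff_rank y z).2 ⟨m, ?_, fun l hl => ?_⟩)
        · rcases lt_trichotomy (L.rank m) (L.rank i) with h | h | h
          · exact absurd ((hy m h).trans (hz m h.le).symm) hm'
          · obtain rfl := L.rank_injective h
            rw [hz m le_rfl] at hm' ⊢
            exact hyi.resolve_right hm'
          · rw [hzw m h.not_ge] at hm' ⊢
            exact hw m _ hm'
        · by_contra hl'
          exact (hmin l (by simpa using hl')).not_gt hl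
      · rintro ⟨i', hi', h3, -⟩
        rw [hy i' hi'] at h3
        exact irrefl_of (L.item i') _ h3
  rw [h1, hB0, h2, zero_add] at hsplit
  rw [hsplit]
  exact hd z

theorem filter_weakUpper_agree_eq {i : Fin p} {o : D i} (x : Bundle D) :
    {y ∈ ({y | y i ∈ weakUpper (L.item i) o} : Finset (Bundle D)) |
        L.agree (L.rank i) y x} =
      ({y | L.agree (L.rank i) y (Function.update x i o) ∧
        y i ∈ weakUpper (L.item i) (Function.update x i o i)} : Finset (Bundle D)) := by
  ext y
  simp only [Finset.mem_filter, Finset.mem_univ, true_and, L.agree_update,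
    Function.update_self]
  exact and_comm

theorem sum_weakUpper_nonneg (hL : L.Represents R)
    (hd : ∀ x, 0 ≤ ∑ y ∈ upperContour R x, d y) {i : Fin p}
    (h0 : ∀ x, ∑ y with L.agree (L.rank i) y x, d y = 0)
    (o : D i) : 0 ≤ ∑ y with y i ∈ weakUpper (L.item i) o, d y := by
  refine sum_nonneg_of_fibers (L.agree (L.rank i)) fun x _ => ?_
  rw [filter_weakUpper_agree_eq]
  exact sum_prefix_weakUpper_nonneg hL hd h0 _

/-- For each upper set of items, the prefix classes contribute nonnegative sums with total zero, so
each vanishes; within a class, vanishing upper sums give vanishing sums item by item. -/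
theorem sum_agree_succ_eq_zero (hL : L.Represents R)
    (hd : ∀ x, 0 ≤ ∑ y ∈ upperContour R x, d y) {i : Fin p}
    (h0 : ∀ x, ∑ y with L.agree (L.rank i) y x, d y = 0)
    (hi : ∀ o, ∑ y with y i ∈ weakUpper (L.item i) o, d y = 0) (x : Bundle D) :
    ∑ y with L.agree (L.rank i + 1) y x, d y = 0 := by
  have := L.item_order i
  have hE : ∀ o, ∑ y with L.agree (L.rank i) y x ∧
      y i ∈ weakUpper (L.item i) o, d y = 0 := by
    intro o
    have h1 : ∀ x' ∈ ({y | y i ∈ weakUpper (L.item i) o} : Finset (Bundle D)),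
        0 ≤ ∑ y ∈ ({y | y i ∈ weakUpper (L.item i) o} : Finset (Bundle D)) with
          L.agree (L.rank i) y x', d y := fun x' _ => by
      rw [filter_weakUpper_agree_eq]
      exact sum_prefix_weakUpper_nonneg hL hd h0 _
    have h2 := fiber_sum_eq_zero _ h1 (hi o) (x := Function.update x i o)
      (by simp [mem_weakUpper])
    simp only [Finset.filter_filter, L.agree_update] at h2
    simpa only [and_comm] using h2
  have hf := eq_zero_of_sum_weakUpper (r := L.item i)
    (f := fun o => ∑ y with L.agree (L.rank i) y x ∧ y i = o, d y)
    (fun o => by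
      rw [← hE o, ← Finset.sum_fiberwise_of_maps_to (s := {y | L.agree (L.rank i) y x ∧ y i ∈ weakUpper (L.item i) o}) (g := fun y => y i)
        (t := weakUpper (L.item i) o) fun y hy => (Finset.mem_filter.1 hy).2.2]
      refine Finset.sum_congr rfl fun o' ho' => ?_
      rw [Finset.filter_filter]
      congr 1
      ext y
      simp only [Finset.mem_filter, Finset.mem_univ, true_and]
      constructor
      · rintro ⟨h1, rfl⟩
        exact ⟨⟨h1, ho'⟩, rfl⟩
      · rintro ⟨⟨h1, -⟩, h2⟩
        exact ⟨h1, h2⟩) (x i)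
  rw [← hf]
  congr 1
  ext y
  simp only [Finset.mem_filter, Finset.mem_univ, true_and, L.agree_iff]
  constructor
  · exact fun h => ⟨fun l hl => h l (by omega), h i (by omega)⟩
  · rintro ⟨h1, h2⟩ l hl
    rcases (Nat.lt_succ_iff.1 hl).lt_or_eq with h | h
    · exact h1 l h
    · obtain rfl := L.rank_injective h
      exact h2

end Prefix

/-! ### Sd-efficiency by induction on importance -/

section Efficiency

variable {p : ℕ} {N : Type*} [Fintype N] {D : Fin p → Type*} [∀ i, Fintype (D i)]

theorem sum_filter_mem_eq {i : Fin p} (f : Bundle D → ℝ) (s : Finset (D i)) :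
    ∑ y with y i ∈ s, f y = ∑ o ∈ s, ∑ y with y i = o, f y := by
  rw [← Finset.sum_fiberwise_of_maps_to (s := {y : Bundle D | y i ∈ s}) (g := fun y => y i)
    (t := s) fun y hy => (Finset.mem_filter.1 hy).2]
  refine Finset.sum_congr rfl fun o ho => ?_
  rw [Finset.filter_filter]
  congr 1
  ext y
  simp only [Finset.mem_filter, Finset.mem_univ, true_and, and_iff_right_iff_imp]
  rintro rfl
  exact ho

theorem isSdEfficient_lexiPS (hcard : ∀ i, Fintype.card (D i) = Fintype.card N)
    {R : N → Bundle D → Bundle D → Prop} {L : N → LexOrder D}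
    (hL : ∀ j, (L j).Represents (R j)) : IsSdEfficient R (lexiPS L) := by
  choose τ hτ using fun i => exists_isEating_lexiPSItem (L := L) hcard i
  have hitem := fun i j => (L j).item_order i
  rintro ⟨Q, hQ, hne, hdom⟩
  set d : N → Bundle D → ℝ := fun j y => Q j y - lexiPS L j y with hdef
  have hd : ∀ j x, 0 ≤ ∑ y ∈ upperContour (R j) x, d j y := fun j x => by
    rw [Finset.sum_sub_distrib]
    exact sub_nonneg.2 (hdom j x)
  have hmarg : ∀ j i o, ∑ y with y i = o, d j y =
      ∑ y with y i = o, Q j y - lexiPSItem L i j o := fun j i o => by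
    rw [Finset.sum_sub_distrib]
    congr 1
    exact sum_prod_filter_eq (q := fun i => lexiPSItem L i j) (fun i => (hτ i).row j) i o
  -- The induction runs over all agents at once, since the marginals of a type are tied together by
  -- its supply.
  have hmain : ∀ k ≤ p, ∀ j x,
      ∑ y with (L j).agree k y x, d j y = 0 := by
    intro k
    induction k with
    | zero =>
      intro _ j x
      rw [Finset.filter_true_of_mem fun y _ => (L j).agree_iff.2 fun i hi =>
        absurd hi (Nat.not_lt_zero _), Finset.sum_sub_distrib, hQ.demand j, sub_eq_zero]
      exact (sum_prod_eq_one (q := fun i => lexiPSItem L i j) fun i => (hτ i).row j).symm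
    | succ k ih =>
      intro hk j x
      have h0 := ih (by omega)
      obtain ⟨i, rfl⟩ := (L j).exists_rank_eq hk
      have heq : ∀ o, ∑ y with y i = o, Q j y = lexiPSItem L i j o := by
        obtain ⟨M, hM⟩ : ∃ M : N → D i → ℝ, ∀ j o, ∑ y with y i = o, Q j y = M j o :=
          ⟨_, fun _ _ => rfl⟩
        have hsupply := hQ.supply i
        have hmarg' := fun j => hmarg j i
        simp only [hM] at hmarg' hsupply ⊢
        -- Agents ranking `i` before position `k` have it in their prefix, so their marginals agree
        -- already; those ranking it at `k` inherit dominance.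
        refine (hτ i).eq_of_dominates (k := (L j).rank i)
          (fun j o => ?_) (fun j' => ?_) hsupply (fun j' hj' o => ?_) (fun j' hj' o => ?_) rfl
        · rw [← hM]
          exact Finset.sum_nonneg fun y _ => hQ.nonneg j y
        · simp only [← hM]
          rw [← hQ.demand j', ← sum_filter_mem_eq]
          simp
        · rw [← sub_eq_zero, ← hmarg']
          refine sum_filter_eq_zero_of_prefix (h0 j') fun y y' hyy' hy => ?_
          rw [← hy]
          exact (L j').agree_iff.1 hyy' i hj'
        · have h1 := sum_weakUpper_nonneg (hL j') (hd j') (i := i)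
            (by rw [hj']; exact h0 j') o
          rw [sum_filter_mem_eq, Finset.sum_congr rfl fun o' _ => hmarg' j' o',
            Finset.sum_sub_distrib] at h1
          exact sub_nonneg.1 h1
      refine sum_agree_succ_eq_zero (hL j) (hd j) (h0 j) (fun o => ?_) x
      rw [sum_filter_mem_eq]
      exact Finset.sum_eq_zero fun o' _ => by rw [hmarg, heq, sub_self]
  refine hne (funext fun j => funext fun x => ?_)
  have h := hmain p le_rfl j x
  rw [Finset.sum_eq_single_of_mem x] at h
  · exact sub_eq_zero.1 h
  · simp only [Finset.mem_filter, Finset.mem_univ, true_and, (L j).agree_iff, implies_true]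
  · intro y hy hyx
    exact absurd (funext fun i => (L j).agree_iff.1 (Finset.mem_filter.1 hy).2 i
      ((L j).rank_lt i)) hyx

end Efficiency

end

end MTRA

theorem mainTheorem1 {p : ℕ} {N : Type*} [Fintype N] {D : Fin p → Type*} [∀ i, Fintype (D i)]
    (hcard : ∀ i, Fintype.card (D i) = Fintype.card N)
    (R : N → MTRA.Bundle D → MTRA.Bundle D → Prop)
    (hR : ∀ j, IsStrictTotalOrder (MTRA.Bundle D) (R j))
    (L : N → MTRA.LexOrder D) (hL : ∀ j, (L j).Represents (R j)) :
    MTRA.IsFractionalAssignment (MTRA.lexiPS L) ∧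
      MTRA.IsSdEfficient R (MTRA.lexiPS L) ∧
      MTRA.IsSdEnvyFree R (MTRA.lexiPS L) ∧
      MTRA.IsDecomposable (MTRA.lexiPS L) := by
  choose τ hτ using fun i => MTRA.exists_isEating_lexiPSItem (L := L) hcard i
  have h0 := fun i => (hτ i).nonneg
  have hrow := fun i => (hτ i).row
  have hcol := fun i => (hτ i).col
  exact ⟨MTRA.isFractionalAssignment_prod h0 hrow hcol, MTRA.isSdEfficient_lexiPS hcard hL,
    MTRA.isSdEnvyFree_lexiPS hcard hL, MTRA.isDecomposable_prod hcard h0 hrow hcol⟩
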